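/- For $f\in L^2(\mathbb R^n)$ write $\hat f(\xi)=\int_{\mathbb R^n} f(x)e^{-ix\cdot\xi}\,dx$ for its Fourier transform (extended to $L^2$ by Plancherel), and, when $\hat f$ is integrable, let $$(e^{it\Delta}f)(x)=\frac1{(2\pi)^n}\int_{\mathbb R^n}\hat f(\xi)\,e^{i(\xi\cdot x+|\xi|^2t)}\,d\xi .$$ Let $B_n(0,1)$ be the unit ball of $\mathbb R^n$. **Theorem (Bourgain).** Fix $n\ge 2$. There is a constant $C=C(n)>1$ such that for every real $s<\frac{n}{2(n+1)}$ there exist a sequence of real numbers $R_k\to\infty$ and a sequence of functions $f_k\in L^2(\mathbb R^n)$ such that $\|f_k\|_{L^2(\mathbb R^n)}=1$ and $\hat f_k$ is supported in the annulus $\{\xi: R_k/C\le|\xi|<CR_k\}$ for every $k$, and $$\lim_{k\to\infty}R_k^{-s}\Big\|\sup_{0<t<1}|e^{it\Delta}f_k(x)|\Big\|_{L^1(B_n(0,1))}=\infty .$$ -/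

import Mathlib

open MeasureTheory Filter Topology
open scoped FourierTransform ENNReal

noncomputable section

/-- The space `L²(ℝⁿ)` of complex-valued functions, for Lebesgue measure. -/
abbrev L2Rn (n : ℕ) : Type :=
  Lp ℂ 2 (volume : Measure (EuclideanSpace ℝ (Fin n)))

/-- The Fourier transform on `L²(ℝⁿ)` in the normalization
`f̂(ξ) = ∫ f(x) e^{-i x·ξ} dx`. It is obtained from Mathlib's (Plancherel) Fourier transform on `L²`,
whose kernel is `e^{-2πi x·ξ}`, by the change of variables `ξ ↦ ξ / (2π)`. -/
def fourierHat {n : ℕ} (f : L2Rn n) (ξ : EuclideanSpace ℝ (Fin n)) : ℂ :=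
  (𝓕 f : L2Rn n) ((2 * Real.pi)⁻¹ • ξ)

/-- The free Schrödinger evolution
`(e^{itΔ} f)(x) = (2π)⁻ⁿ ∫ f̂(ξ) e^{i(ξ·x + |ξ|² t)} dξ`. The integral converges absolutely whenever
`f̂` is integrable, in particular whenever `f ∈ L²` has a Fourier transform of bounded support. -/
def schrodingerEvolution {n : ℕ} (t : ℝ) (f : L2Rn n) (x : EuclideanSpace ℝ (Fin n)) : ℂ :=
  (((2 * Real.pi) ^ n)⁻¹ : ℝ) *
    ∫ ξ : EuclideanSpace ℝ (Fin n),
      fourierHat f ξ * Complex.exp (Complex.I * ((inner ℝ ξ x + ‖ξ‖ ^ 2 * t : ℝ) : ℂ))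

/-- The maximal function `sup_{0<t<1} |(e^{itΔ} f)(x)|`, with values in `[0, ∞]`. -/
def schrodingerMaximal {n : ℕ} (f : L2Rn n) (x : EuclideanSpace ℝ (Fin n)) : ℝ≥0∞ :=
  ⨆ t ∈ Set.Ioo (0 : ℝ) 1, ‖schrodingerEvolution t f x‖ₑ

/-- The annulus `{ξ : R/C ≤ |ξ| < C R}` in `ℝⁿ`. -/
def annulus (n : ℕ) (R C : ℝ) : Set (EuclideanSpace ℝ (Fin n)) :=
  {ξ | R / C ≤ ‖ξ‖ ∧ ‖ξ‖ < C * R}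

/-- `f̂` is supported in `S`: as an element of `L²` it vanishes almost everywhere outside `S`. -/
def FourierSupportedIn {n : ℕ} (f : L2Rn n) (S : Set (EuclideanSpace ℝ (Fin n))) : Prop :=
  ∀ᵐ ξ : EuclideanSpace ℝ (Fin n), ξ ∉ S → fourierHat f ξ = 0

end

/-! If f̂ is a normalized indicator of Ω, the evolution has size about |Ω|^(1/2) wherever the phases
ξ·x + |ξ|²t, ξ ∈ Ω, agree up to 1 modulo 2π. With n = m + 1 and R = L^(2n+2), Ω is an interval of
length about L^(n+1) at height R in the first coordinate, times combs of L short teeth with spacing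
D = R/L in the others. Then |Ω|^(1/2) is about L^n = R^(n/(2(n+1))), the critical power.

The first phase is stationary at t₀ = -x₀/(2R), and a delay of order L^(n-1)/D² is harmless. If D²t
= 2πa with a an integer, the phases quadratic in the tooth index l disappear modulo 2π. Shifting
comb j by Dν_j, with 2ν_j = K^(-(j+1)) and K = cL, makes its linear phase 2πl(Dx_j/2π + a/K^(j+1)),
so the base-K digits of a tune all n-1 linear phases at once. A suitable a lies in every window of
length K^(n-1), which is the allowed delay. Hence every x in a fixed cube with x₀ < 0 has a coherent
time, and no Gauss sums are needed. -/

/-! ### Digit selection and coherent phases -/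

/-- Integer digits: the multiples `a / K, a / K², …, a / K ^ J` modulo one can be prescribed
simultaneously up to `1 / K`, with `a` in any window of length `K ^ J`. -/
theorem exists_int_simultaneous_approx {K : ℕ} (hK : 0 < K) (y : ℕ → ℝ) (J : ℕ) (u : ℝ) :
    ∃ a : ℤ, u < a ∧ (a : ℝ) ≤ u + (K : ℝ) ^ J ∧ ∀ j < J, ∃ b : ℤ,
      0 ≤ y j + a / (K : ℝ) ^ (j + 1) - b ∧ y j + a / (K : ℝ) ^ (j + 1) - b ≤ 1 / K := by
  have hK' : (0 : ℝ) < K := by exact_mod_cast hK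
  have key : ∀ J : ℕ, ∃ a : ℤ, ∀ j < J, ∃ b : ℤ,
      0 ≤ y j + a / (K : ℝ) ^ (j + 1) - b ∧ y j + a / (K : ℝ) ^ (j + 1) - b ≤ 1 / K := by
    intro J
    induction J with
    | zero => exact ⟨0, fun j hj => absurd hj (Nat.not_lt_zero j)⟩
    | succ J ih =>
      obtain ⟨a, ha⟩ := ih
      set z : ℝ := y J + a / (K : ℝ) ^ (J + 1)
      -- A multiple of K^J moves the earlier quantities by integers and the new one by a multiple of
      -- 1/K, which leaves the fractional part of Kz divided by K.
      refine ⟨a + (K : ℤ) ^ J * (-⌊K * z⌋), fun j hj => ?_⟩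
      rcases Nat.lt_succ_iff_lt_or_eq.mp hj with h | rfl
      · obtain ⟨b, hb⟩ := ha j h
        obtain ⟨d, rfl⟩ := Nat.exists_eq_add_of_lt h
        refine ⟨b + (K : ℤ) ^ d * (-⌊K * z⌋), ?_⟩
        have : y j + ((a + (K : ℤ) ^ (j + d + 1) * (-⌊K * z⌋) : ℤ) : ℝ) / (K : ℝ) ^ (j + 1)
            - ((b + (K : ℤ) ^ d * (-⌊K * z⌋) : ℤ) : ℝ) = y j + a / (K : ℝ) ^ (j + 1) - b := by
          push_cast
          field_simp
          ring
        rw [this]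
        exact hb
      · refine ⟨0, ?_⟩
        have : y j + ((a + (K : ℤ) ^ j * (-⌊K * z⌋) : ℤ) : ℝ) / (K : ℝ) ^ (j + 1)
            - ((0 : ℤ) : ℝ) = (K * z - ⌊K * z⌋) / K := by
          simp only [z]
          push_cast
          field_simp
          ring
        rw [this]
        have h1 := Int.floor_le (K * z)
        have h2 := Int.lt_floor_add_one (K * z)
        exact ⟨div_nonneg (by linarith) hK'.le, by gcongr; linarith⟩
  obtain ⟨a, ha⟩ := key J
  have hKJ : (0 : ℝ) < (K : ℝ) ^ J := by positivity
  -- Translating by multiples of K^J preserves all the conditions, so a can be moved into the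
  -- window.
  set e : ℤ := ⌊(u - a) / (K : ℝ) ^ J⌋ + 1
  have he1 : (u - a) / (K : ℝ) ^ J < e := by
    simp only [e]; push_cast; exact Int.lt_floor_add_one _
  have he2 : (e : ℝ) - 1 ≤ (u - a) / (K : ℝ) ^ J := by
    simp only [e]; push_cast; simpa using Int.floor_le _
  rw [div_lt_iff₀ hKJ] at he1
  rw [le_div_iff₀ hKJ] at he2
  refine ⟨a + (K : ℤ) ^ J * e, by push_cast; linarith, by push_cast; linarith, fun j hj => ?_⟩
  obtain ⟨b, hb⟩ := ha j hj
  obtain ⟨d, rfl⟩ := Nat.exists_eq_add_of_lt hj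
  refine ⟨b + (K : ℤ) ^ d * e, ?_⟩
  have : y j + ((a + (K : ℤ) ^ (j + d + 1) * e : ℤ) : ℝ) / (K : ℝ) ^ (j + 1)
      - ((b + (K : ℤ) ^ d * e : ℤ) : ℝ) = y j + a / (K : ℝ) ^ (j + 1) - b := by
    push_cast
    field_simp
    ring
  rw [this]
  exact hb

/-- An oscillatory integral whose phase is within `1` of a constant modulo `2π` has no
cancellation. -/
theorem half_measure_le_norm_integral_exp {α : Type*} [MeasurableSpace α] {μ : Measure α}
    {s : Set α} (hs : MeasurableSet s) (hμs : μ s ≠ ∞) {φ : α → ℝ} (hφ : Measurable φ) (φ₀ : ℝ)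
    (h : ∀ ξ ∈ s, ∃ p : ℤ, |φ ξ - φ₀ - 2 * Real.pi * p| ≤ 1) :
    (μ s).toReal / 2 ≤ ‖∫ ξ in s, Complex.exp (Complex.I * (φ ξ : ℂ)) ∂μ‖ := by
  have hint : IntegrableOn (fun ξ => Complex.exp (Complex.I * ((φ ξ - φ₀ : ℝ) : ℂ))) s μ := by
    refine Measure.integrableOn_of_bounded (M := 1) hμs ?_ ?_
    · exact (by fun_prop : Measurable fun ξ =>
        Complex.exp (Complex.I * ((φ ξ - φ₀ : ℝ) : ℂ))).aestronglyMeasurable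
    · filter_upwards with ξ
      rw [mul_comm, Complex.norm_exp_ofReal_mul_I]
  have hfac : ∫ ξ in s, Complex.exp (Complex.I * (φ ξ : ℂ)) ∂μ =
      Complex.exp (Complex.I * (φ₀ : ℂ)) *
        ∫ ξ in s, Complex.exp (Complex.I * ((φ ξ - φ₀ : ℝ) : ℂ)) ∂μ := by
    rw [← integral_const_mul]
    congr 1
    ext ξ
    rw [← Complex.exp_add]
    congr 1
    push_cast
    ring
  rw [hfac, norm_mul, mul_comm Complex.I, Complex.norm_exp_ofReal_mul_I, one_mul]
  refine le_trans ?_ (Complex.re_le_norm _)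
  have hre : (∫ ξ in s, Complex.exp (Complex.I * ((φ ξ - φ₀ : ℝ) : ℂ)) ∂μ).re =
      ∫ ξ in s, Real.cos (φ ξ - φ₀) ∂μ := by
    have := integral_re (𝕜 := ℂ) hint
    simp only [RCLike.re_eq_complex_re] at this
    rw [← this]
    congr 1
    ext ξ
    rw [mul_comm, Complex.exp_ofReal_mul_I_re]
  have hcint : IntegrableOn (fun ξ => Real.cos (φ ξ - φ₀)) s μ := by
    refine Measure.integrableOn_of_bounded (M := 1) hμs ?_ ?_
    · exact (by fun_prop : Measurable fun ξ => Real.cos (φ ξ - φ₀)).aestronglyMeasurable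
    · filter_upwards with ξ
      exact Real.abs_cos_le_one _
  rw [hre]
  have hc : ∫ _ in s, (1 / 2 : ℝ) ∂μ = (μ s).toReal / 2 := by
    rw [setIntegral_const, smul_eq_mul, Measure.real]
    ring
  rw [← hc]
  -- Pointwise, cos y ≥ 1 - y²/2 ≥ 1/2 for |y| ≤ 1.
  refine setIntegral_mono_on (integrableOn_const hμs) hcint hs fun ξ hξ => ?_
  obtain ⟨p, hp⟩ := h ξ hξ
  have hcos : Real.cos (φ ξ - φ₀) = Real.cos (φ ξ - φ₀ - 2 * Real.pi * p) := by
    rw [show 2 * Real.pi * (p : ℝ) = p * (2 * Real.pi) by ring, Real.cos_sub_int_mul_two_pi]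
  rw [hcos]
  have h1 := Real.one_sub_sq_div_two_le_cos (x := φ ξ - φ₀ - 2 * Real.pi * p)
  have h2 := (sq_le_one_iff_abs_le_one _).mpr hp
  linarith

/-- The transversal coordinates: frequencies `D (l + ν) + η` with `l < L` and `η` small have
coherent phases at times with `D² t ∈ 2π ℤ`. -/
theorem exists_phase_sub_le_transversal {D L w t x ν κ θ : ℝ} {a b : ℤ} (l : ℕ) {η : ℝ}
    (hD : 0 ≤ D) (ht0 : 0 ≤ t) (ht1 : t ≤ 1) (hDLt : D * L * t ≤ 1) (hx : |x| ≤ 1)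
    (hw1 : w ≤ 1) (hη0 : 0 ≤ η) (hηw : η ≤ w) (hν0 : 0 ≤ ν) (hν : ν ≤ 1) (hl : (l : ℝ) + 1 ≤ L)
    (hDt : D ^ 2 * t = 2 * Real.pi * a)
    (hθ : D * x / (2 * Real.pi) + a * (2 * ν) - b = θ) (hθ0 : 0 ≤ θ) (hθκ : θ ≤ κ) :
    ∃ p : ℤ, |(D * (l + ν) + η) * x + (D * (l + ν) + η) ^ 2 * t
      - (D * ν * x + D ^ 2 * ν ^ 2 * t) - 2 * Real.pi * p| ≤ 2 * Real.pi * (L * κ) + 4 * w := by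
  -- The term l²D²t equals 2πl²a, and l(Dx + 2νD²t) equals 2πl(θ + b). The remaining terms in η
  -- contribute w + 2w + w.
  refine ⟨l ^ 2 * a + l * b, ?_⟩
  have hDx : D * x = 2 * Real.pi * (θ + b - a * (2 * ν)) := by
    rw [← hθ]
    field_simp
    ring
  have hid : (D * (l + ν) + η) * x + (D * (l + ν) + η) ^ 2 * t
      - (D * ν * x + D ^ 2 * ν ^ 2 * t) - 2 * Real.pi * ((l ^ 2 * a + l * b : ℤ) : ℝ)
      = 2 * Real.pi * (l * θ) + η * x + 2 * (D * (l + ν) * t) * η + η * η * t := by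
    push_cast
    linear_combination (l : ℝ) * hDx + ((l : ℝ) ^ 2 + 2 * l * ν) * hDt
  rw [hid]
  have hl0 : (0 : ℝ) ≤ l := Nat.cast_nonneg l
  have hw0 : 0 ≤ w := hη0.trans hηw
  have h1 : (l : ℝ) * θ ≤ L * κ := by
    apply mul_le_mul <;> linarith
  have h1' : 0 ≤ (l : ℝ) * θ := by positivity
  have h2 : |η * x| ≤ w := by
    rw [abs_mul, abs_of_nonneg hη0]
    exact (mul_le_of_le_one_right hη0 hx).trans hηw
  have h3 : D * (l + ν) * t ≤ 1 := by
    refine le_trans ?_ hDLt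
    gcongr
    linarith
  have h3' : 0 ≤ D * (l + ν) * t := by positivity
  have h4 : D * (l + ν) * t * η ≤ w := (mul_le_of_le_one_left hη0 h3).trans hηw
  have h4' : 0 ≤ D * (l + ν) * t * η := by positivity
  have h5 : η * η * t ≤ w := by
    have h : η * η ≤ η := mul_le_of_le_one_left hη0 (hηw.trans hw1)
    exact (mul_le_of_le_one_right (mul_nonneg hη0 hη0) ht1).trans (h.trans hηw)
  have h5' : 0 ≤ η * η * t := by positivity
  have hpi := Real.pi_pos
  have h6 := mul_le_mul_of_nonneg_left h1 (by positivity : 0 ≤ 2 * Real.pi)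
  have h6' := mul_nonneg (by positivity : 0 ≤ 2 * Real.pi) h1'
  obtain ⟨h7, h8⟩ := abs_le.mp h2
  rw [abs_le]
  constructor <;> linarith

/-! ### From coherent frequencies to large evolutions -/

/-- Normalized indicator functions in frequency: a set of frequencies with coherent phases at
`(x, t)` forces a large evolution there. -/
theorem exists_norm_one_fourierSupportedIn_le_norm_schrodingerEvolution {n : ℕ}
    {Ω : Set (EuclideanSpace ℝ (Fin n))} (hΩ : MeasurableSet Ω) (h0 : volume Ω ≠ 0)
    (htop : volume Ω ≠ ∞) :
    ∃ f : L2Rn n, ‖f‖ = 1 ∧ FourierSupportedIn f Ω ∧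
      ∀ (x : EuclideanSpace ℝ (Fin n)) (t φ₀ : ℝ),
        (∀ ξ ∈ Ω, ∃ p : ℤ, |inner ℝ ξ x + ‖ξ‖ ^ 2 * t - φ₀ - 2 * Real.pi * p| ≤ 1) →
        ((2 * Real.pi) ^ n)⁻¹ / 2 * √(volume Ω).toReal ≤ ‖schrodingerEvolution t f x‖ := by
  have hpi : (0 : ℝ) < 2 * Real.pi := by positivity
  have hpi1 : (1 : ℝ) ≤ 2 * Real.pi := by linarith [Real.pi_gt_three]
  set Ω' : Set (EuclideanSpace ℝ (Fin n)) := (fun ζ => (2 * Real.pi) • ζ) ⁻¹' Ω with hΩ'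
  have hm' : MeasurableSet Ω' := (measurable_const_smul (2 * Real.pi)) hΩ
  have hv : volume Ω' = ENNReal.ofReal (((2 * Real.pi) ^ n)⁻¹) * volume Ω := by
    rw [hΩ', Measure.addHaar_preimage_smul volume hpi.ne', finrank_euclideanSpace_fin,
      abs_of_pos (by positivity)]
  have htop' : volume Ω' ≠ ∞ := by
    rw [hv]; exact ENNReal.mul_ne_top ENNReal.ofReal_ne_top htop
  have hvr : (volume Ω').toReal = ((2 * Real.pi) ^ n)⁻¹ * (volume Ω).toReal := by
    rw [hv, ENNReal.toReal_mul, ENNReal.toReal_ofReal (by positivity)]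
  have hΩpos : 0 < (volume Ω).toReal := ENNReal.toReal_pos h0 htop
  have hΩpos' : 0 < (volume Ω').toReal := by rw [hvr]; positivity
  set c : ℝ := (√(volume Ω').toReal)⁻¹
  have hc : 0 < c := by positivity
  set G : L2Rn n := indicatorConstLp 2 hm' htop' (c : ℂ)
  have hF : (𝓕 (𝓕⁻ G : L2Rn n) : L2Rn n) = G := FourierTransform.fourier_fourierInv_eq G
  have hnorm : ‖(𝓕⁻ G : L2Rn n)‖ = 1 := by
    rw [← Lp.norm_fourier_eq, hF, norm_indicatorConstLp (by norm_num) (by norm_num)]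
    rw [Complex.norm_real, Real.norm_of_nonneg hc.le, Measure.real]
    simp only [c, ENNReal.toReal_ofNat, ← Real.sqrt_eq_rpow]
    exact inv_mul_cancel₀ (by positivity)
  have hhat : ∀ᵐ ξ : EuclideanSpace ℝ (Fin n),
      fourierHat (𝓕⁻ G : L2Rn n) ξ = Ω.indicator (fun _ => (c : ℂ)) ξ := by
    have hG : (G : EuclideanSpace ℝ (Fin n) → ℂ) =ᵐ[volume] Ω'.indicator fun _ => (c : ℂ) :=
      indicatorConstLp_coeFn
    have h1 : volume ((fun ξ : EuclideanSpace ℝ (Fin n) => (2 * Real.pi)⁻¹ • ξ) ⁻¹'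
        {ζ | ¬ G ζ = Ω'.indicator (fun _ => (c : ℂ)) ζ}) = 0 := by
      rw [Measure.addHaar_preimage_smul volume (inv_ne_zero hpi.ne')]
      rw [show volume {ζ | ¬ G ζ = Ω'.indicator (fun _ => (c : ℂ)) ζ} = 0 from hG, mul_zero]
    have h2 : ∀ᵐ ξ : EuclideanSpace ℝ (Fin n), G ((2 * Real.pi)⁻¹ • ξ) =
        Ω'.indicator (fun _ => (c : ℂ)) ((2 * Real.pi)⁻¹ • ξ) := h1
    filter_upwards [h2] with ξ hξ
    rw [fourierHat, hF, hξ]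
    have : (2 * Real.pi)⁻¹ • ξ ∈ Ω' ↔ ξ ∈ Ω := by
      rw [hΩ', Set.mem_preimage, smul_inv_smul₀ hpi.ne']
    by_cases hmem : ξ ∈ Ω
    · rw [Set.indicator_of_mem hmem, Set.indicator_of_mem (this.mpr hmem)]
    · rw [Set.indicator_of_notMem hmem, Set.indicator_of_notMem (mt this.mp hmem)]
  refine ⟨(𝓕⁻ G : L2Rn n), hnorm, ?_, fun x t φ₀ h => ?_⟩
  · filter_upwards [hhat] with ξ hξ hξΩ
    rw [hξ, Set.indicator_of_notMem hξΩ]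
  · have hev : schrodingerEvolution t (𝓕⁻ G : L2Rn n) x = (((2 * Real.pi) ^ n)⁻¹ : ℝ) *
        ((c : ℂ) * ∫ ξ in Ω, Complex.exp (Complex.I * ((inner ℝ ξ x + ‖ξ‖ ^ 2 * t : ℝ) : ℂ))) := by
      rw [schrodingerEvolution, ← integral_const_mul (c : ℂ), ← integral_indicator hΩ]
      congr 1
      refine integral_congr_ae ?_
      filter_upwards [hhat] with ξ hξ
      rw [hξ]
      by_cases hmem : ξ ∈ Ω <;> simp [hmem]
    have hlow := half_measure_le_norm_integral_exp hΩ htop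
      (φ := fun ξ => inner ℝ ξ x + ‖ξ‖ ^ 2 * t) (by fun_prop) φ₀ h
    rw [hev, norm_mul, norm_mul, Complex.norm_real, Complex.norm_real, Real.norm_of_nonneg hc.le,
      Real.norm_of_nonneg (by positivity)]
    -- The rescaled set Ω' is no larger than Ω, so replacing its volume by that of Ω only lowers the
    -- bound.
    have hcle : (√(volume Ω).toReal)⁻¹ ≤ c := by
      simp only [c]
      refine inv_anti₀ (Real.sqrt_pos.mpr hΩpos') (Real.sqrt_le_sqrt ?_)
      rw [hvr]
      exact mul_le_of_le_one_left hΩpos.le (inv_le_one_of_one_le₀ (one_le_pow₀ hpi1))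
    calc ((2 * Real.pi) ^ n)⁻¹ / 2 * √(volume Ω).toReal
        = ((2 * Real.pi) ^ n)⁻¹ * ((√(volume Ω).toReal)⁻¹ * ((volume Ω).toReal / 2)) := by
          have := Real.mul_self_sqrt hΩpos.le
          have h3 : 0 < √(volume Ω).toReal := by positivity
          field_simp
          rw [Real.sq_sqrt hΩpos.le]
      _ ≤ _ := by gcongr

/-! ### The frequency set: volume and location -/

/-- A product set in Euclidean space. -/
def euclideanBox {n : ℕ} (T : Fin n → Set ℝ) : Set (EuclideanSpace ℝ (Fin n)) :=
  {ξ | ∀ i, ξ i ∈ T i}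

theorem euclideanBox_eq_preimage {n : ℕ} (T : Fin n → Set ℝ) :
    euclideanBox T = WithLp.ofLp ⁻¹' Set.univ.pi T := by
  ext ξ
  simp [euclideanBox]

theorem measurableSet_euclideanBox {n : ℕ} {T : Fin n → Set ℝ} (hT : ∀ i, MeasurableSet (T i)) :
    MeasurableSet (euclideanBox T) := by
  rw [euclideanBox_eq_preimage]
  exact (PiLp.volume_preserving_ofLp (Fin n)).measurable (MeasurableSet.univ_pi hT)

theorem volume_euclideanBox {n : ℕ} {T : Fin n → Set ℝ} (hT : ∀ i, MeasurableSet (T i)) :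
    volume (euclideanBox T) = ∏ i, volume (T i) := by
  rw [euclideanBox_eq_preimage, (PiLp.volume_preserving_ofLp (Fin n)).measure_preimage
    (MeasurableSet.univ_pi hT).nullMeasurableSet, volume_pi_pi]

/-- The union of `L` intervals of length `w` starting at the points `D (l + ν)`. -/
def comb (D ν w : ℝ) (L : ℕ) : Set ℝ :=
  ⋃ l ∈ Finset.range L, Set.Icc (D * (l + ν)) (D * (l + ν) + w)

theorem mem_comb {D ν w z : ℝ} {L : ℕ} :
    z ∈ comb D ν w L ↔ ∃ l < L, D * (l + ν) ≤ z ∧ z ≤ D * (l + ν) + w := by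
  simp [comb, and_left_comm]

theorem measurableSet_comb (D ν w : ℝ) (L : ℕ) : MeasurableSet (comb D ν w L) :=
  Finset.measurableSet_biUnion _ fun _ _ => measurableSet_Icc

theorem volume_comb {D ν w : ℝ} (hD : 0 ≤ D) (hwD : w < D) (L : ℕ) :
    volume (comb D ν w L) = ENNReal.ofReal w * L := by
  rw [comb, measure_biUnion_finset]
  · simp [mul_comm]
  · have key : ∀ l l' : ℕ, l < l' → Disjoint (Set.Icc (D * (l + ν)) (D * (l + ν) + w))
        (Set.Icc (D * (l' + ν)) (D * (l' + ν) + w)) := by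
      intro l l' h
      rw [Set.disjoint_left]
      rintro z ⟨_, h1⟩ ⟨h2, _⟩
      have h3 : (l : ℝ) + 1 ≤ l' := by exact_mod_cast h
      have h4 : D * (l + 1) ≤ D * l' := by gcongr
      linarith
    intro l _ l' _ h
    rcases lt_or_gt_of_ne h with h | h
    · exact key l l' h
    · exact (key l' l h).symm
  · exact fun _ _ => measurableSet_Icc

/-- The frequency set: a long interval at height `R` times combs of spacing `D`. -/
def frequencySet {m : ℕ} (R S D w : ℝ) (L : ℕ) (ν : Fin m → ℝ) : Fin (m + 1) → Set ℝ :=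
  Fin.cons (α := fun _ => Set ℝ) (Set.Icc R (R + S)) fun j => comb D (ν j) w L

theorem measurableSet_frequencySet {m : ℕ} (R S D w : ℝ) (L : ℕ) (ν : Fin m → ℝ)
    (i : Fin (m + 1)) : MeasurableSet (frequencySet R S D w L ν i) := by
  refine Fin.cases ?_ (fun j => ?_) i
  · exact measurableSet_Icc
  · exact measurableSet_comb _ _ _ _

theorem volume_euclideanBox_frequencySet {m : ℕ} {R S D w : ℝ} (hD : 0 ≤ D) (hw : 0 ≤ w)
    (hS : 0 ≤ S) (hwD : w < D) (L : ℕ) (ν : Fin m → ℝ) :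
    volume (euclideanBox (frequencySet R S D w L ν)) = ENNReal.ofReal (S * (w * L) ^ m) := by
  rw [volume_euclideanBox (measurableSet_frequencySet R S D w L ν), Fin.prod_univ_succ]
  simp only [frequencySet, Fin.cons_zero, Fin.cons_succ, Real.volume_Icc, volume_comb hD hwD,
    Finset.prod_const, Finset.card_univ, Fintype.card_fin]
  rw [ENNReal.ofReal_mul hS, ENNReal.ofReal_pow (by positivity), ENNReal.ofReal_mul hw,
    ENNReal.ofReal_natCast, add_sub_cancel_left]

theorem EuclideanSpace.norm_le_sum_abs {n : ℕ} (x : EuclideanSpace ℝ (Fin n)) :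
    ‖x‖ ≤ ∑ i, |x i| := by
  rw [EuclideanSpace.norm_eq]
  refine Real.sqrt_le_iff.mpr ⟨Finset.sum_nonneg fun _ _ => abs_nonneg _, ?_⟩
  simp only [Real.norm_eq_abs]
  exact Finset.sum_sq_le_sq_sum_of_nonneg fun _ _ => abs_nonneg _

theorem EuclideanSpace.abs_apply_le_norm {n : ℕ} (x : EuclideanSpace ℝ (Fin n)) (i : Fin n) :
    |x i| ≤ ‖x‖ := by
  simpa using PiLp.norm_apply_le x i

/-- The first coordinate alone gives the lower bound. Shifts at most 1/2 and teeth at most D/2 long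
keep each comb inside [0, DL]. -/
theorem euclideanBox_frequencySet_subset_annulus {m : ℕ} {R S D w : ℝ} {L : ℕ} {ν : Fin m → ℝ}
    (hR : 0 < R) (hS : S ≤ R) (hD : 0 ≤ D) (hw : w ≤ D / 2) (hDL : D * L ≤ R)
    (hν0 : ∀ j, 0 ≤ ν j) (hν : ∀ j, ν j ≤ 1 / 2) :
    euclideanBox (frequencySet R S D w L ν) ⊆ annulus (m + 1) R (2 * (m + 1) + 1) := by
  intro ξ hξ
  have h0 : ξ 0 ∈ Set.Icc R (R + S) := hξ 0
  have hj : ∀ j : Fin m, |ξ j.succ| ≤ R := by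
    intro j
    obtain ⟨l, hl, h1, h2⟩ := mem_comb.mp (show ξ j.succ ∈ comb D (ν j) w L from hξ j.succ)
    have h3 : 0 ≤ D * (l + ν j) := by have := hν0 j; positivity
    have h4 : (l : ℝ) + 1 ≤ L := by exact_mod_cast hl
    have h5 : D * (l + ν j) ≤ D * (L - 1 / 2) := by
      gcongr
      linarith [hν j]
    rw [abs_of_nonneg (h3.trans h1)]
    linarith
  have hm : (0 : ℝ) ≤ m := Nat.cast_nonneg m
  constructor
  · have h1 := EuclideanSpace.abs_apply_le_norm ξ 0
    rw [abs_of_nonneg (hR.le.trans h0.1)] at h1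
    refine le_trans ?_ (h0.1.trans h1)
    exact div_le_self hR.le (by linarith)
  · refine (EuclideanSpace.norm_le_sum_abs ξ).trans_lt ?_
    rw [Fin.sum_univ_succ, abs_of_nonneg (hR.le.trans h0.1)]
    have h1 : ∑ j : Fin m, |ξ j.succ| ≤ ∑ _j : Fin m, R := Finset.sum_le_sum fun j _ => hj j
    simp only [Finset.sum_const, Finset.card_univ, Fintype.card_fin, nsmul_eq_mul] at h1
    have h2 : 0 ≤ m * R := by positivity
    linarith [h0.2]

/-! ### The coherent time -/

theorem phase_eq_sum {n : ℕ} (ξ x : EuclideanSpace ℝ (Fin n)) (t : ℝ) :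
    inner ℝ ξ x + ‖ξ‖ ^ 2 * t = ∑ i, (ξ i * x i + ξ i ^ 2 * t) := by
  rw [EuclideanSpace.real_norm_sq_eq, PiLp.inner_apply, Finset.sum_add_distrib, Finset.sum_mul]
  simp [mul_comm]

/-- The phase splits over coordinates, so errors and multiples of 2π add; only the transversal
coordinates need such multiples. -/
theorem exists_phase_sub_le_of_coordinates {m : ℕ} {ξ x : EuclideanSpace ℝ (Fin (m + 1))}
    {t φ ε δ : ℝ} {ψ : Fin m → ℝ} (h0 : |ξ 0 * x 0 + ξ 0 ^ 2 * t - φ| ≤ ε)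
    (h : ∀ j : Fin m, ∃ p : ℤ,
      |ξ j.succ * x j.succ + ξ j.succ ^ 2 * t - ψ j - 2 * Real.pi * p| ≤ δ) :
    ∃ p : ℤ, |inner ℝ ξ x + ‖ξ‖ ^ 2 * t - (φ + ∑ j, ψ j) - 2 * Real.pi * p| ≤ ε + m * δ := by
  choose p hp using h
  refine ⟨∑ j, p j, ?_⟩
  have hid : inner ℝ ξ x + ‖ξ‖ ^ 2 * t - (φ + ∑ j, ψ j) - 2 * Real.pi * ((∑ j, p j : ℤ) : ℝ) =
      (ξ 0 * x 0 + ξ 0 ^ 2 * t - φ) + ∑ j : Fin m,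
        (ξ j.succ * x j.succ + ξ j.succ ^ 2 * t - ψ j - 2 * Real.pi * p j) := by
    rw [phase_eq_sum, Fin.sum_univ_succ, Finset.sum_sub_distrib, Finset.sum_sub_distrib,
      ← Finset.mul_sum]
    push_cast
    ring
  rw [hid]
  refine (abs_add_le _ _).trans (add_le_add h0 ((Finset.abs_sum_le_sum_abs _ _).trans ?_))
  refine (Finset.sum_le_sum fun j _ => hp j).trans ?_
  simp

/-- For every `x` in a fixed cube there is a time at which all frequencies of the frequency set
have coherent phases. -/
theorem exists_time_coherent {m L : ℕ} {c : ℕ} (hc : 20 * (m + 1) ≤ c) (hL : c ^ (m + 1) ≤ L)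
    {x : EuclideanSpace ℝ (Fin (m + 1))} (hx : ∀ i, |x i| ≤ 1) (hx0 : x 0 < 0) :
    ∃ t ∈ Set.Ioo (0 : ℝ) 1, ∃ φ₀ : ℝ,
      ∀ ξ ∈ euclideanBox (frequencySet ((L : ℝ) ^ (2 * m + 4))
        (((c : ℝ) ^ (m + 1))⁻¹ * (L : ℝ) ^ (m + 2)) ((L : ℝ) ^ (2 * m + 3)) ((c : ℝ) ^ (m + 1))⁻¹ L
        fun j : Fin m => 1 / (2 * ((c * L : ℕ) : ℝ) ^ ((j : ℕ) + 1))),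
        ∃ p : ℤ, |inner ℝ ξ x + ‖ξ‖ ^ 2 * t - φ₀ - 2 * Real.pi * p| ≤ 1 := by
  have hpi := Real.pi_pos
  have hpi3 := Real.pi_gt_three
  have hpi4 := Real.pi_le_four
  have hc' : (20 : ℝ) * (m + 1) ≤ c := by exact_mod_cast hc
  have hm : (0 : ℝ) ≤ m := Nat.cast_nonneg m
  have hc20 : (20 : ℝ) ≤ c := by linarith
  have hc0 : (0 : ℝ) < c := by linarith
  have hcm : (1 : ℝ) ≤ (c : ℝ) ^ m := one_le_pow₀ (by linarith)
  have hℓc : (c : ℝ) ^ (m + 1) ≤ L := by exact_mod_cast hL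
  have hℓ20 : 20 * (c : ℝ) ^ m ≤ L := by
    refine le_trans ?_ hℓc
    rw [pow_succ, mul_comm]
    gcongr
  have hℓ1 : (1 : ℝ) < L := by linarith
  have hℓ0 : (0 : ℝ) < L := by linarith
  have hL0 : 0 < L := by exact_mod_cast hℓ0
  have hcnat : 0 < c := by exact_mod_cast hc0
  have hK : 0 < c * L := Nat.mul_pos hcnat hL0
  set ℓ : ℝ := (L : ℝ) with hℓ
  set w : ℝ := ((c : ℝ) ^ (m + 1))⁻¹ with hw
  have hw0 : 0 < w := by positivity
  have hwc : w * (c : ℝ) ^ m = 1 / c := by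
    rw [hw, pow_succ]; field_simp
  have hwle : w ≤ 1 / c := by
    rw [← hwc]; exact le_mul_of_one_le_right hw0.le hcm
  have hc1 : 1 / (c : ℝ) ≤ 1 := by rw [div_le_one hc0]; linarith
  set D : ℝ := ℓ ^ (2 * m + 3) with hD
  set R : ℝ := ℓ ^ (2 * m + 4) with hR
  have hD0 : 0 < D := by positivity
  have hR0 : 0 < R := by positivity
  have hR1 : 1 < R := one_lt_pow₀ hℓ1 (by omega)
  have hDL : D * ℓ = R := by rw [hD, hR]; ring
  -- The window for a starts at D²t₀/2π, so t falls just after the stationary time t₀. The value 0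
  -- for j ≥ m is a dummy.
  obtain ⟨a, ha1, ha2, hab⟩ := exists_int_simultaneous_approx hK
    (fun j => if h : j < m then D * x (Fin.succ ⟨j, h⟩) / (2 * Real.pi) else 0) m
    (D ^ 2 * (-x 0 / (2 * R)) / (2 * Real.pi))
  set t : ℝ := 2 * Real.pi * a / D ^ 2 with ht
  have hDt : D ^ 2 * t = 2 * Real.pi * a := by rw [ht]; field_simp
  set t₀ : ℝ := -x 0 / (2 * R) with ht₀
  have ht₀0 : 0 < t₀ := div_pos (by linarith) (by positivity)
  have htl : t₀ < t := by
    rw [div_lt_iff₀ (by positivity)] at ha1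
    rw [ht, lt_div_iff₀ (by positivity)]
    linarith
  have htpos : 0 < t := ht₀0.trans htl
  have htu : D ^ 2 * (t - t₀) ≤ 2 * Real.pi * ((c : ℝ) * ℓ) ^ m := by
    have h1 : 2 * Real.pi * (a : ℝ) ≤ D ^ 2 * t₀ + 2 * Real.pi * ((c : ℝ) * ℓ) ^ m := by
      have h2 := mul_le_mul_of_nonneg_left ha2 (by positivity : 0 ≤ 2 * Real.pi)
      rw [mul_add, mul_div_cancel₀ _ (by positivity)] at h2
      push_cast at h2
      exact h2
    rw [mul_sub, hDt]
    linarith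
  -- The powers of L balance here: the delay times the interval length w L^(m+2) costs only 2πw c^m
  -- = 2π/c in phase.
  have hwin : R * (t - t₀) * ℓ ^ (m + 2) ≤ 2 * Real.pi * (c : ℝ) ^ m := by
    have h1 : R * (t - t₀) * ℓ ^ (m + 2) * ℓ ^ m = D ^ 2 * (t - t₀) := by rw [hR, hD]; ring
    rw [mul_pow, ← mul_assoc, ← h1] at htu
    exact le_of_mul_le_mul_right htu (by positivity)
  have hRt₀ : 2 * (R * t₀) = -x 0 := by rw [ht₀]; field_simp
  have hx00 := hx 0
  rw [abs_of_neg hx0] at hx00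
  have hτ0 : 0 ≤ R * (t - t₀) := mul_nonneg hR0.le (by linarith)
  -- Since x₀ ≥ -1, R t₀ ≤ 1/2; the delay adds at most 1/2.
  have hRt : R * t ≤ 1 := by
    have h1 : R * (t - t₀) * ℓ ≤ R * (t - t₀) * ℓ ^ (m + 2) := by
      gcongr
      exact le_self_pow₀ hℓ1.le (by omega)
    have h2 : R * (t - t₀) * ℓ ≤ 1 / 2 * ℓ := by
      refine h1.trans (hwin.trans ?_)
      have : 2 * Real.pi * (c : ℝ) ^ m ≤ 10 * (c : ℝ) ^ m := by gcongr; linarith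
      linarith
    have h3 := le_of_mul_le_mul_right h2 hℓ0
    linarith
  have ht1 : t < 1 := by
    refine lt_of_lt_of_le ?_ hRt
    exact lt_mul_of_one_lt_left htpos hR1
  refine ⟨t, ⟨htpos, ht1⟩, R * x 0 + R ^ 2 * t + ∑ j : Fin m,
    (D * (1 / (2 * ((c * L : ℕ) : ℝ) ^ ((j : ℕ) + 1))) * x j.succ
      + D ^ 2 * (1 / (2 * ((c * L : ℕ) : ℝ) ^ ((j : ℕ) + 1))) ^ 2 * t), fun ξ hξ => ?_⟩
  -- At most 16/c comes from the linear term, 1/c from the quadratic one.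
  have hlong : |ξ 0 * x 0 + ξ 0 ^ 2 * t - (R * x 0 + R ^ 2 * t)| ≤ 17 / c := by
    obtain ⟨h1, h2⟩ : ξ 0 ∈ Set.Icc R (R + w * ℓ ^ (m + 2)) := hξ 0
    obtain ⟨η, hη⟩ : ∃ η, ξ 0 = R + η := ⟨ξ 0 - R, by ring⟩
    have hη0 : 0 ≤ η := by linarith
    have hη1 : η ≤ w * ℓ ^ (m + 2) := by linarith
    have hid : ξ 0 * x 0 + ξ 0 ^ 2 * t - (R * x 0 + R ^ 2 * t) =
        2 * (η * (R * (t - t₀))) + η * η * t := by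
      rw [hη]
      linear_combination η * hRt₀
    have h3 : η * (R * (t - t₀)) ≤ 2 * Real.pi / c := by
      calc η * (R * (t - t₀)) ≤ w * ℓ ^ (m + 2) * (R * (t - t₀)) := by gcongr
        _ = w * (R * (t - t₀) * ℓ ^ (m + 2)) := by ring
        _ ≤ w * (2 * Real.pi * (c : ℝ) ^ m) := by gcongr
        _ = 2 * Real.pi * (w * (c : ℝ) ^ m) := by ring
        _ = 2 * Real.pi / c := by rw [hwc]; ring
    have h4 : η * η * t ≤ 1 / c := by
      calc η * η * t ≤ w * ℓ ^ (m + 2) * (w * ℓ ^ (m + 2)) * t := by gcongr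
        _ = w * w * (R * t) := by rw [hR]; ring
        _ ≤ w * w * 1 := by gcongr
        _ ≤ 1 * (1 / c) * 1 := by gcongr; exact hwle.trans hc1
        _ = 1 / c := by ring
    rw [hid, abs_of_nonneg (by positivity)]
    have h5 : 2 * (2 * Real.pi / c) ≤ 2 * (8 / c) := by gcongr; linarith
    have h6 : 2 * (8 / (c : ℝ)) + 1 / c = 17 / c := by ring
    linarith
  -- Here 12/c bounds 2πL/K + 4w, with L/K = 1/c and w ≤ 1/c.
  have htrans := exists_phase_sub_le_of_coordinates (δ := 12 / c)
    (ψ := fun j : Fin m => D * (1 / (2 * ((c * L : ℕ) : ℝ) ^ ((j : ℕ) + 1))) * x j.succ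
      + D ^ 2 * (1 / (2 * ((c * L : ℕ) : ℝ) ^ ((j : ℕ) + 1))) ^ 2 * t) hlong fun j => by
    obtain ⟨l, hl, h1, h2⟩ := mem_comb.mp (show ξ j.succ ∈ comb _ _ w L from hξ j.succ)
    obtain ⟨b, hb0, hb1⟩ := hab j j.2
    simp only [j.2, dif_pos, Fin.eta] at hb0 hb1
    have hK1 : (1 : ℝ) ≤ ((c * L : ℕ) : ℝ) := by exact_mod_cast hK
    have hν : 1 / (2 * ((c * L : ℕ) : ℝ) ^ ((j : ℕ) + 1)) ≤ 1 := by
      rw [div_le_one (by positivity)]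
      have := one_le_pow₀ hK1 (n := (j : ℕ) + 1)
      linarith
    have ha : (a : ℝ) / ((c * L : ℕ) : ℝ) ^ ((j : ℕ) + 1) =
        a * (2 * (1 / (2 * ((c * L : ℕ) : ℝ) ^ ((j : ℕ) + 1)))) := by
      field_simp
    rw [ha] at hb0 hb1
    obtain ⟨p, hp⟩ := exists_phase_sub_le_transversal (L := ℓ) (w := w) l
      (η := ξ j.succ - D * (l + 1 / (2 * ((c * L : ℕ) : ℝ) ^ ((j : ℕ) + 1)))) hD0.le htpos.le
      ht1.le (by rw [hDL]; exact hRt) (hx j.succ) (hwle.trans hc1) (by linarith) (by linarith)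
      (by positivity) hν (by rw [hℓ]; exact_mod_cast hl) hDt rfl hb0 hb1
    refine ⟨p, ?_⟩
    rw [add_sub_cancel] at hp
    refine hp.trans ?_
    have h5 : ℓ * (1 / ((c * L : ℕ) : ℝ)) = 1 / c := by
      rw [Nat.cast_mul, ← hℓ]
      field_simp
    have h6 : 2 * Real.pi * (1 / (c : ℝ)) ≤ 8 * (1 / c) := by gcongr; linarith
    rw [h5]
    have h7 : 12 / (c : ℝ) = 12 * (1 / c) := by ring
    linarith
  obtain ⟨p, hp⟩ := htrans
  refine ⟨p, hp.trans ?_⟩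
  have : 17 / (c : ℝ) + m * (12 / c) = (17 + m * 12) / c := by ring
  rw [this, div_le_one hc0]
  linarith

/-! ### Maximal function bound and limit -/

/-- Normalized functions at frequency `L ^ (2 m + 4)` in dimension `m + 1` whose maximal function
is at least a constant times `L ^ (m + 1)` on a fixed cube. -/
theorem exists_le_schrodingerMaximal (m : ℕ) {c L : ℕ} (hc : 20 * (m + 1) ≤ c)
    (hL : c ^ (m + 1) ≤ L) :
    ∃ f : L2Rn (m + 1), ‖f‖ = 1 ∧
      FourierSupportedIn f (annulus (m + 1) ((L : ℝ) ^ (2 * m + 4)) (2 * (m + 1) + 1)) ∧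
      ∀ x : EuclideanSpace ℝ (Fin (m + 1)), (∀ i, |x i| ≤ 1) → x 0 < 0 →
        ENNReal.ofReal (((2 * Real.pi) ^ (m + 1))⁻¹ / 2 * √(((c : ℝ) ^ (m + 1))⁻¹ ^ (m + 1)) *
          (L : ℝ) ^ (m + 1)) ≤ schrodingerMaximal f x := by
  have hc2 : (2 : ℝ) ≤ c := by exact_mod_cast (by omega : 2 ≤ c)
  have hcm : (2 : ℝ) ≤ (c : ℝ) ^ (m + 1) := hc2.trans (le_self_pow₀ (by linarith) (by omega))
  have hℓ : (2 : ℝ) ≤ L := hcm.trans (by exact_mod_cast hL)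
  set w : ℝ := ((c : ℝ) ^ (m + 1))⁻¹ with hw
  have hw0 : 0 < w := by positivity
  have hw1 : w ≤ 1 / 2 := by
    rw [hw, inv_eq_one_div]; gcongr
  set D : ℝ := (L : ℝ) ^ (2 * m + 3) with hD
  set R : ℝ := (L : ℝ) ^ (2 * m + 4) with hR
  set S : ℝ := w * (L : ℝ) ^ (m + 2) with hS
  set ν : Fin m → ℝ := fun j => 1 / (2 * ((c * L : ℕ) : ℝ) ^ ((j : ℕ) + 1)) with hν
  have hD2 : 2 ≤ D := hℓ.trans (le_self_pow₀ (by linarith) (by omega))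
  have hν0 : ∀ j, 0 ≤ ν j := fun j => by simp only [hν]; positivity
  have hν1 : ∀ j, ν j ≤ 1 / 2 := fun j => by
    have hK1 : (1 : ℝ) ≤ ((c * L : ℕ) : ℝ) := by
      push_cast
      exact one_le_mul_of_one_le_of_one_le (by linarith) (by linarith)
    have := one_le_pow₀ hK1 (n := (j : ℕ) + 1)
    simp only [hν]
    gcongr
    linarith
  have hSR : S ≤ R := by
    calc S ≤ 1 * (L : ℝ) ^ (m + 2) := by rw [hS]; gcongr; linarith
      _ = (L : ℝ) ^ (m + 2) := one_mul _
      _ ≤ R := pow_le_pow_right₀ (by linarith) (by omega)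
  have hvol := volume_euclideanBox_frequencySet (m := m) (R := R) (S := S) (D := D) (w := w)
    (by linarith) hw0.le (by positivity) (by linarith) L ν
  -- The volume is a constant times a perfect square, whose root is L^(m+1).
  have hVeq : S * (w * L) ^ m = w ^ (m + 1) * ((L : ℝ) ^ (m + 1)) ^ 2 := by rw [hS]; ring
  have hV0 : 0 < S * (w * L) ^ m := by positivity
  obtain ⟨f, hf, hfs, hev⟩ := exists_norm_one_fourierSupportedIn_le_norm_schrodingerEvolution
    (measurableSet_euclideanBox (measurableSet_frequencySet R S D w L ν))
    (by rw [hvol]; exact (ENNReal.ofReal_pos.mpr hV0).ne') (by rw [hvol]; exact ENNReal.ofReal_ne_top)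
  rw [hvol, ENNReal.toReal_ofReal hV0.le, hVeq, Real.sqrt_mul (by positivity),
    Real.sqrt_sq (by positivity), ← mul_assoc] at hev
  refine ⟨f, hf, ?_, fun x hx hx0 => ?_⟩
  · filter_upwards [hfs] with ξ hξ hξA
    refine hξ fun hmem => hξA ?_
    exact euclideanBox_frequencySet_subset_annulus (by positivity) hSR (by linarith)
      (by linarith) (by rw [hD, hR]; exact (pow_succ _ _).symm.le) hν0 hν1 hmem
  · obtain ⟨t, ht, φ₀, hφ⟩ := exists_time_coherent hc hL hx hx0
    refine le_trans ?_ (le_iSup₂ (f := fun t (_ : t ∈ Set.Ioo (0 : ℝ) 1) =>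
      ‖schrodingerEvolution t f x‖ₑ) t ht)
    rw [← ofReal_norm]
    exact ENNReal.ofReal_le_ofReal (hev x t φ₀ hφ)

/-- A cube inside the unit ball. -/
theorem euclideanBox_Ioo_subset_ball {n : ℕ} (hn : 0 < n) :
    euclideanBox (fun _ : Fin n => Set.Ioo (-(1 / n : ℝ)) 0) ⊆ Metric.ball 0 1 := by
  intro x hx
  have : Nonempty (Fin n) := ⟨⟨0, hn⟩⟩
  have hn' : (0 : ℝ) < n := by exact_mod_cast hn
  rw [mem_ball_zero_iff]
  refine (EuclideanSpace.norm_le_sum_abs x).trans_lt ?_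
  have h1 : ∑ i, |x i| < ∑ _i : Fin n, (1 / n : ℝ) :=
    Finset.sum_lt_sum_of_nonempty Finset.univ_nonempty fun i _ => by
      rw [abs_of_neg (hx i).2]
      linarith [(hx i).1]
  refine h1.trans_eq ?_
  simp [hn'.ne']

theorem theorem1p1 (n : ℕ) (hn : 2 ≤ n) :
    ∃ C : ℝ, 1 < C ∧
      ∀ s : ℝ, s < (n : ℝ) / (2 * ((n : ℝ) + 1)) →
        ∃ (R : ℕ → ℝ) (f : ℕ → L2Rn n),
          Tendsto R atTop atTop ∧
          (∀ k, ‖f k‖ = 1) ∧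
          (∀ k, FourierSupportedIn (f k) (annulus n (R k) C)) ∧
          Tendsto
            (fun k => ENNReal.ofReal (R k ^ (-s)) *
              eLpNorm (schrodingerMaximal (f k)) 1
                (volume.restrict (Metric.ball (0 : EuclideanSpace ℝ (Fin n)) 1)))
            atTop (𝓝 ∞) := by
  obtain ⟨m, rfl⟩ : ∃ m, n = m + 1 := ⟨n - 1, by omega⟩
  have hm : (0 : ℝ) ≤ m := Nat.cast_nonneg m
  refine ⟨2 * (m + 1) + 1, by linarith, fun s hs => ?_⟩
  set c : ℕ := 20 * (m + 1)
  set N : ℕ := c ^ (m + 1) with hN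
  have hN0 : 0 < N := by positivity
  choose f hf hfs hmax using fun k : ℕ =>
    exists_le_schrodingerMaximal m (c := c) (L := k + N) le_rfl (Nat.le_add_left _ _)
  have hL : Tendsto (fun k : ℕ => ((k + N : ℕ) : ℝ)) atTop atTop :=
    tendsto_natCast_atTop_atTop.comp (tendsto_add_atTop_nat N)
  refine ⟨fun k => ((k + N : ℕ) : ℝ) ^ (2 * m + 4), f,
    (tendsto_pow_atTop (by omega)).comp hL, hf, hfs, ?_⟩
  set A : ℝ := ((2 * Real.pi) ^ (m + 1))⁻¹ / 2 * √(((c : ℝ) ^ (m + 1))⁻¹ ^ (m + 1)) with hA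
  have hc0 : (0 : ℝ) < c := by positivity
  have hA0 : 0 < A := by
    have := Real.pi_pos
    positivity
  set Q : Set (EuclideanSpace ℝ (Fin (m + 1))) :=
    euclideanBox (fun _ : Fin (m + 1) => Set.Ioo (-(1 / (m + 1 : ℕ) : ℝ)) 0)
  have hQm : MeasurableSet Q := measurableSet_euclideanBox fun _ => measurableSet_Ioo
  have hQv : volume Q = ENNReal.ofReal ((1 / (m + 1 : ℕ) : ℝ) ^ (m + 1)) := by
    rw [volume_euclideanBox fun _ => measurableSet_Ioo]
    simp only [Real.volume_Ioo, Finset.prod_const, Finset.card_univ, Fintype.card_fin]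
    rw [ENNReal.ofReal_pow (by positivity)]
    congr 2
    ring
  set V : ℝ := (1 / (m + 1 : ℕ) : ℝ) ^ (m + 1) with hV
  have hV0 : 0 < V := by positivity
  have hnorm : ∀ k, ENNReal.ofReal (A * ((k + N : ℕ) : ℝ) ^ (m + 1) * V) ≤
      eLpNorm (schrodingerMaximal (f k)) 1
        (volume.restrict (Metric.ball (0 : EuclideanSpace ℝ (Fin (m + 1))) 1)) := by
    intro k
    rw [eLpNorm_one_eq_lintegral_enorm, ENNReal.ofReal_mul (by positivity), ← hQv,
      ← setLIntegral_const]
    refine le_trans ?_ (lintegral_mono_set (euclideanBox_Ioo_subset_ball (Nat.succ_pos m)))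
    refine setLIntegral_mono' hQm fun x hx => ?_
    rw [enorm_eq_self]
    refine hmax k x (fun i => ?_) (hx 0).2
    rw [abs_of_neg (hx i).2]
    have h1 : (1 / (m + 1 : ℕ) : ℝ) ≤ 1 := by
      rw [div_le_one (by positivity)]
      push_cast
      linarith
    linarith [(hx i).1]
  -- This is s < n/(2(n+1)) rewritten: L^(m+1) beats R^s = L^((2m+4)s).
  have hexp : 0 < (m + 1 : ℕ) - (2 * m + 4 : ℕ) * s := by
    rw [lt_div_iff₀ (by positivity)] at hs
    push_cast at hs ⊢
    linarith
  have hlim : Tendsto (fun k : ℕ => ENNReal.ofReal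
      (A * V * ((k + N : ℕ) : ℝ) ^ ((m + 1 : ℕ) - (2 * m + 4 : ℕ) * s))) atTop (𝓝 ∞) :=
    ENNReal.tendsto_ofReal_atTop.comp
      (((tendsto_rpow_atTop hexp).comp hL).const_mul_atTop (by positivity))
  refine tendsto_nhds_top_mono' hlim fun k => ?_
  refine le_trans (le_of_eq ?_) (mul_le_mul_right (hnorm k) _)
  have hk : (0 : ℝ) < ((k + N : ℕ) : ℝ) := by positivity
  rw [← ENNReal.ofReal_mul (by positivity), Real.rpow_sub hk, Real.rpow_natCast,
    Real.rpow_mul hk.le, Real.rpow_natCast, Real.rpow_neg (by positivity)]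
  congr 1
  field_simp
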